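/- For a commutative ring $R$ let $\mathbb{Z}/2\mathbb{Z}$ act on the group scheme $\mathrm{SL}_{3,R}$ over $\mathrm{Spec}(R)$ by letting the nontrivial element act by \[ M \mapsto J \cdot {}^{\mathrm{t}}M^{-1} \cdot J, \qquad J = \begin{pmatrix} 0 & 0 & -1 \\ 0 & 1 & 0 \\ -1 & 0 & 0 \end{pmatrix}, \] and let $(\mathrm{SL}_{3,R})^{\mathbb{Z}/2\mathbb{Z}}$ be the fixed-point group scheme, i.e. the closed subgroup scheme of $\mathrm{SL}_{3,R}$ whose points in an $R$-algebra $A$ are the matrices $M \in \mathrm{SL}_3(A)$ with $J \cdot {}^{\mathrm{t}}M^{-1} \cdot J = M$. Its formation commutes with base change in $R$; in particular the base change of $(\mathrm{SL}_{3,\mathbb{Z}_2})^{\mathbb{Z}/2\mathbb{Z}}$ to $\mathrm{Spec}(\mathbb{F}_2)$ is $(\mathrm{SL}_{3,\mathbb{F}_2})^{\mathbb{Z}/2\mathbb{Z}}$, where $\mathbb{Z}_2$ is the ring of $2$-adic integers and $\mathbb{F}_2$ its residue field. Let $\mathbf{H}$ be a flat affine group scheme over $\mathbb{Z}_2$, and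 let $\pi : \mathbf{H} \to (\mathrm{SL}_{3,\mathbb{Z}_2})^{\mathbb{Z}/2\mathbb{Z}}$ be a morphism of group schemes over $\mathbb{Z}_2$ such that the base change \[ \pi_{|\mathrm{Spec}(\mathbb{F}_2)} : \mathrm{Spec}(\mathbb{F}_2) \times_{\mathrm{Spec}(\mathbb{Z}_2)} \mathbf{H} \to (\mathrm{SL}_{3,\mathbb{F}_2})^{\mathbb{Z}/2\mathbb{Z}} \] is surjective on underlying topological spaces. Then the schematic image of $\pi_{|\mathrm{Spec}(\mathbb{F}_2)}$ is the whole of $(\mathrm{SL}_{3,\mathbb{F}_2})^{\mathbb{Z}/2\mathbb{Z}}$. -/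

import Mathlib

open CategoryTheory Limits AlgebraicGeometry TensorProduct

open scoped Matrix

noncomputable section

namespace SLFix

universe u

/-- The coordinate ring `R[x_ij] / (det - 1)` of `SL_3` over `R`. -/
def SLRing (R : Type u) [CommRing R] : Type u :=
  MvPolynomial (Fin 3 × Fin 3) R ⧸
    Ideal.span {(Matrix.mvPolynomialX (Fin 3) (Fin 3) R).det - 1}

namespace SLRing

variable (R : Type u) [CommRing R]

instance instCommRing : CommRing (SLRing R) :=
  inferInstanceAs (CommRing (MvPolynomial (Fin 3 × Fin 3) R ⧸
    Ideal.span {(Matrix.mvPolynomialX (Fin 3) (Fin 3) R).det - 1}))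

instance instAlgebra : Algebra R (SLRing R) :=
  inferInstanceAs (Algebra R (MvPolynomial (Fin 3 × Fin 3) R ⧸
    Ideal.span {(Matrix.mvPolynomialX (Fin 3) (Fin 3) R).det - 1}))

/-- The quotient map from the polynomial ring. -/
def mk : MvPolynomial (Fin 3 × Fin 3) R →ₐ[R] SLRing R :=
  Ideal.Quotient.mkₐ R (Ideal.span {(Matrix.mvPolynomialX (Fin 3) (Fin 3) R).det - 1})

/-- The universal matrix of determinant one. -/
def gen : Matrix (Fin 3) (Fin 3) (SLRing R) :=
  (Matrix.mvPolynomialX (Fin 3) (Fin 3) R).map (mk R)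

@[simp]
theorem det_gen : (gen R).det = 1 := by
  have h : (gen R).det = mk R (Matrix.mvPolynomialX (Fin 3) (Fin 3) R).det :=
    (AlgHom.map_det (mk R) _).symm
  rw [h, ← map_one (mk R), ← sub_eq_zero, ← map_sub]
  exact Ideal.Quotient.eq_zero_iff_mem.mpr (Ideal.subset_span rfl)

variable {R}

/-- A matrix of determinant one in an `R`-algebra is an `A`-valued point of `SL_3`. -/
def lift {A : Type*} [CommRing A] [Algebra R A] (M : Matrix (Fin 3) (Fin 3) A)
    (hM : M.det = 1) : SLRing R →ₐ[R] A :=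
  Ideal.Quotient.liftₐ _ (MvPolynomial.aeval fun p : Fin 3 × Fin 3 ↦ M p.1 p.2) <| by
    intro a ha
    rw [← RingHom.mem_ker]
    refine (Ideal.span_le.mpr ?_) ha
    rintro _ rfl
    have h : (Matrix.mvPolynomialX (Fin 3) (Fin 3) R).map
        (MvPolynomial.aeval fun p : Fin 3 × Fin 3 ↦ M p.1 p.2) = M := by
      ext i j; simp
    have h' := AlgHom.map_det (MvPolynomial.aeval (R := R) fun p : Fin 3 × Fin 3 ↦ M p.1 p.2)
      (Matrix.mvPolynomialX (Fin 3) (Fin 3) R)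
    rw [AlgHom.mapMatrix_apply, h, hM] at h'
    simp [RingHom.mem_ker, h']

@[simp]
theorem lift_gen {A : Type*} [CommRing A] [Algebra R A] (M : Matrix (Fin 3) (Fin 3) A)
    (hM : M.det = 1) (i j : Fin 3) : lift (R := R) M hM (gen R i j) = M i j := by
  change MvPolynomial.aeval (fun p : Fin 3 × Fin 3 ↦ M p.1 p.2)
    (Matrix.mvPolynomialX (Fin 3) (Fin 3) R i j) = M i j
  simp

theorem map_gen_lift {A : Type*} [CommRing A] [Algebra R A] (M : Matrix (Fin 3) (Fin 3) A)
    (hM : M.det = 1) : (gen R).map (lift (R := R) M hM) = M := by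
  ext i j; simp

theorem hom_ext {A : Type*} [CommRing A] [Algebra R A] {f g : SLRing R →ₐ[R] A}
    (h : (gen R).map f = (gen R).map g) : f = g := by
  refine Ideal.Quotient.algHom_ext R ?_
  refine MvPolynomial.algHom_ext fun p ↦ ?_
  have := congrFun (congrFun h p.1) p.2
  exact this

theorem det_map {A B : Type*} [CommRing A] [CommRing B] (f : A →+* B)
    {M : Matrix (Fin 3) (Fin 3) A} (hM : M.det = 1) : (M.map f).det = 1 := by
  have := RingHom.map_det f M
  rw [hM, map_one] at this
  exact this.symm

theorem map_inv {A B : Type*} [CommRing A] [CommRing B] (f : A →+* B)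
    {M : Matrix (Fin 3) (Fin 3) A} (hM : M.det = 1) : (M⁻¹).map f = (M.map f)⁻¹ := by
  symm
  apply Matrix.inv_eq_left_inv
  rw [← Matrix.map_mul, Matrix.nonsing_inv_mul _ (by simp [hM]), Matrix.map_one _ (map_zero f) (map_one f)]

theorem det_inv {A : Type*} [CommRing A]
    {M : Matrix (Fin 3) (Fin 3) A} (hM : M.det = 1) : (M⁻¹).det = 1 := by
  simp [Matrix.det_nonsing_inv, hM]

variable (R)

/-- The comultiplication `x_ij ↦ ∑ k, x_ik ⊗ x_kj`. -/
def comulHom : SLRing R →ₐ[R] SLRing R ⊗[R] SLRing R :=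
  lift ((gen R).map (Algebra.TensorProduct.includeLeft : SLRing R →ₐ[R] SLRing R ⊗[R] SLRing R) *
    (gen R).map (Algebra.TensorProduct.includeRight : SLRing R →ₐ[R] SLRing R ⊗[R] SLRing R)) <| by
    rw [Matrix.det_mul]
    erw [det_map (Algebra.TensorProduct.includeLeft :
      SLRing R →ₐ[R] SLRing R ⊗[R] SLRing R).toRingHom (det_gen R),
      det_map (Algebra.TensorProduct.includeRight :
      SLRing R →ₐ[R] SLRing R ⊗[R] SLRing R).toRingHom (det_gen R)]
    rw [mul_one]

/-- The counit, given by the identity matrix. -/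
def counitHom : SLRing R →ₐ[R] R := lift 1 Matrix.det_one

/-- The antipode, given by the inverse of the universal matrix. -/
def antipodeHom : SLRing R →ₐ[R] SLRing R := lift (gen R)⁻¹ (det_inv (det_gen R))

theorem comulHom_gen (i j : Fin 3) :
    comulHom R (gen R i j) = ∑ k, gen R i k ⊗ₜ[R] gen R k j := by
  simp [comulHom, Matrix.mul_apply]

theorem counitHom_gen (i j : Fin 3) :
    counitHom R (gen R i j) = (1 : Matrix (Fin 3) (Fin 3) R) i j := by
  simp [counitHom]

theorem antipodeHom_gen (i j : Fin 3) : antipodeHom R (gen R i j) = (gen R)⁻¹ i j := by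
  simp [antipodeHom]

instance instBialgebra : Bialgebra R (SLRing R) :=
  Bialgebra.ofAlgHom (comulHom R) (counitHom R)
    (by
      apply hom_ext
      ext i j
      simp [comulHom_gen, sum_tmul, tmul_sum]
      exact Finset.sum_comm)
    (by
      apply hom_ext
      ext i j
      simp [comulHom_gen, counitHom_gen, Matrix.one_apply, ite_tmul])
    (by
      apply hom_ext
      ext i j
      simp [comulHom_gen, counitHom_gen, Matrix.one_apply, tmul_ite])

theorem map_gen_comp {A B : Type*} [CommRing A] [Algebra R A] [CommRing B] [Algebra R B]
    (f : SLRing R →ₐ[R] A) (g : A →ₐ[R] B) :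
    (gen R).map (g.comp f) = ((gen R).map f).map g := by
  ext i j; simp

theorem map_inv' {A : Type*} [CommRing A] [Algebra R A] (f : SLRing R →ₐ[R] A) :
    ((gen R)⁻¹).map f = ((gen R).map f)⁻¹ :=
  map_inv (f : SLRing R →+* A) (det_gen R)

theorem det_map_gen {A : Type*} [CommRing A] [Algebra R A] (f : SLRing R →ₐ[R] A) :
    ((gen R).map f).det = 1 :=
  det_map (f : SLRing R →+* A) (det_gen R)

theorem map_gen_lift_comul {A : Type*} [CommRing A] [Algebra R A] (f g : SLRing R →ₐ[R] A) :
    (gen R).map ((Algebra.TensorProduct.lift f g fun _ _ ↦ Commute.all _ _).comp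
      (Bialgebra.comulAlgHom R (SLRing R))) = (gen R).map f * (gen R).map g := by
  ext i j
  change (Algebra.TensorProduct.lift f g fun _ _ ↦ Commute.all _ _) (comulHom R (gen R i j)) = _
  simp [comulHom_gen, Matrix.mul_apply]

theorem map_gen_counit {A : Type*} [CommRing A] [Algebra R A] :
    (gen R).map ((Algebra.ofId R A).comp (Bialgebra.counitAlgHom R (SLRing R))) = 1 := by
  ext i j
  change Algebra.ofId R A (counitHom R (gen R i j)) = _
  rw [counitHom_gen, Matrix.one_apply, Matrix.one_apply]
  split <;> simp

theorem map_gen_id : (gen R).map (AlgHom.id R (SLRing R)) = gen R := by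
  ext i j; simp

theorem map_gen_antipode : (gen R).map (antipodeHom R) = (gen R)⁻¹ := by
  ext i j; simp [antipodeHom_gen]

instance instHopfAlgebra : HopfAlgebra R (SLRing R) :=
  HopfAlgebra.ofAlgHom (antipodeHom R)
    (by
      apply hom_ext
      rw [map_gen_lift_comul, map_gen_counit, map_gen_antipode, map_gen_id,
        Matrix.nonsing_inv_mul _ (by simp)])
    (by
      apply hom_ext
      rw [map_gen_lift_comul, map_gen_counit, map_gen_antipode, map_gen_id,
        Matrix.mul_nonsing_inv _ (by simp)])

end SLRing

/-- The antidiagonal matrix with entries `-1, 1, -1`. -/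
def J (A : Type*) [CommRing A] : Matrix (Fin 3) (Fin 3) A :=
  !![0, 0, -1; 0, 1, 0; -1, 0, 0]

theorem J_mul_J (A : Type*) [CommRing A] : J A * J A = 1 := by
  ext i j
  fin_cases i <;> fin_cases j <;> simp [J, Matrix.mul_apply, Fin.sum_univ_three]

/-- The involution `M ↦ J ᵗM⁻¹ J`. -/
def twist {A : Type*} [CommRing A] (M : Matrix (Fin 3) (Fin 3) A) : Matrix (Fin 3) (Fin 3) A :=
  J A * (M⁻¹)ᵀ * J A

theorem det_twist {A : Type*} [CommRing A] {M : Matrix (Fin 3) (Fin 3) A} (hM : M.det = 1) :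
    (twist M).det = 1 := by
  have h := congrArg Matrix.det (J_mul_J A)
  rw [Matrix.det_mul, Matrix.det_one] at h
  rw [twist, Matrix.det_mul, Matrix.det_mul, Matrix.det_transpose, SLRing.det_inv hM, mul_one, h]

theorem twist_mul {A : Type*} [CommRing A] (M N : Matrix (Fin 3) (Fin 3) A) :
    twist (M * N) = twist M * twist N := by
  have h : twist M * twist N = J A * (M⁻¹)ᵀ * (J A * J A) * (N⁻¹)ᵀ * J A := by
    simp only [twist, Matrix.mul_assoc]
  rw [h, J_mul_J, mul_one, twist, Matrix.mul_inv_rev, Matrix.transpose_mul]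
  simp only [Matrix.mul_assoc]

theorem twist_one {A : Type*} [CommRing A] : twist (1 : Matrix (Fin 3) (Fin 3) A) = 1 := by
  simp [twist, J_mul_J]

theorem twist_inv {A : Type*} [CommRing A] {M : Matrix (Fin 3) (Fin 3) A} (hM : M.det = 1) :
    twist M⁻¹ = (twist M)⁻¹ := by
  symm
  apply Matrix.inv_eq_left_inv
  rw [← twist_mul, Matrix.nonsing_inv_mul _ (by simp [hM]), twist_one]

theorem twist_twist {A : Type*} [CommRing A] {M : Matrix (Fin 3) (Fin 3) A} (hM : M.det = 1) :
    twist (twist M) = M := by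
  have h : (J A)⁻¹ = J A := Matrix.inv_eq_left_inv (J_mul_J A)
  have hJ : (J A)ᵀ = J A := by
    ext i j
    fin_cases i <;> fin_cases j <;> simp [J]
  have h1 : (twist M)⁻¹ = J A * Mᵀ * J A := by
    rw [← twist_inv hM, twist, Matrix.nonsing_inv_nonsing_inv _ (by simp [hM])]
  rw [twist, h1, Matrix.transpose_mul, Matrix.transpose_mul, hJ, Matrix.transpose_transpose]
  calc J A * (J A * (M * J A)) * J A = (J A * J A) * M * (J A * J A) := by
        simp only [Matrix.mul_assoc]
    _ = M := by simp [J_mul_J]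

theorem map_twist {A B : Type*} [CommRing A] [CommRing B] (f : A →+* B)
    {M : Matrix (Fin 3) (Fin 3) A} (hM : M.det = 1) : (twist M).map f = twist (M.map f) := by
  have hJ : (J A).map f = J B := by
    ext i j
    fin_cases i <;> fin_cases j <;> simp [J]
  rw [twist, twist, Matrix.map_mul, Matrix.map_mul, hJ, Matrix.transpose_map,
    SLRing.map_inv f hM]

section Fixed

variable (R : Type u) [CommRing R]

/-- The automorphism of the coordinate ring of `SL_3` through which the nontrivial element of
`ℤ/2ℤ` acts: on points it is `M ↦ J ᵗM⁻¹ J`. -/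
def sigma : SLRing R →ₐ[R] SLRing R :=
  SLRing.lift (twist (SLRing.gen R)) (det_twist (SLRing.det_gen R))

theorem map_gen_comp_sigma {A : Type*} [CommRing A] [Algebra R A] (f : SLRing R →ₐ[R] A) :
    (SLRing.gen R).map (f.comp (sigma R)) = twist ((SLRing.gen R).map f) := by
  rw [SLRing.map_gen_comp, sigma, SLRing.map_gen_lift]
  exact map_twist (f : SLRing R →+* A) (SLRing.det_gen R)

/-- `sigma` is an involution, so it does define an action of `ℤ/2ℤ`. -/
theorem sigma_comp_sigma : (sigma R).comp (sigma R) = AlgHom.id R (SLRing R) := by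
  apply SLRing.hom_ext
  rw [map_gen_comp_sigma, sigma, SLRing.map_gen_lift, twist_twist (SLRing.det_gen R),
    SLRing.map_gen_id]

/-- The ideal generated by the elements `r - σ r`; it cuts out the fixed points. -/
def fixedIdeal : Ideal (SLRing R) := Ideal.span (Set.range fun r ↦ r - sigma R r)

theorem fixedIdeal_le_ker {A : Type*} [CommRing A] [Algebra R A] (f : SLRing R →ₐ[R] A)
    (hf : twist ((SLRing.gen R).map f) = (SLRing.gen R).map f) :
    fixedIdeal R ≤ RingHom.ker f := by
  refine Ideal.span_le.mpr ?_
  rintro _ ⟨r, rfl⟩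
  have h : f.comp (sigma R) = f := SLRing.hom_ext ((map_gen_comp_sigma R f).trans hf)
  have h' : f (sigma R r) = f r := DFunLike.congr_fun h r
  simp [RingHom.mem_ker, h']

theorem twist_map_gen {A : Type*} [CommRing A] [Algebra R A] (f : SLRing R →ₐ[R] A)
    (hf : fixedIdeal R ≤ RingHom.ker f) :
    twist ((SLRing.gen R).map f) = (SLRing.gen R).map f := by
  rw [← map_gen_comp_sigma]
  ext i j
  have h := hf (Ideal.subset_span ⟨SLRing.gen R i j, rfl⟩)
  simp only [RingHom.mem_ker, map_sub, sub_eq_zero] at h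
  exact h.symm

theorem ker_mk_fixedIdeal :
    fixedIdeal R ≤ RingHom.ker (Ideal.Quotient.mkₐ R (fixedIdeal R)) := by
  intro x hx
  simpa [RingHom.mem_ker, Ideal.Quotient.eq_zero_iff_mem] using hx

instance instIsHopfIdeal : (fixedIdeal R).IsHopfIdeal R where
  counit_eq_zero := by
    intro x hx
    have h := fixedIdeal_le_ker R (Bialgebra.counitAlgHom R (SLRing R)) (by
      have := SLRing.map_gen_counit R (A := R)
      have h1 : (Algebra.ofId R R).comp (Bialgebra.counitAlgHom R (SLRing R)) =
        Bialgebra.counitAlgHom R (SLRing R) := by ext; simp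
      rw [h1] at this
      rw [this, twist_one])
    exact h hx
  map_mkQ_comul_eq_zero := by
    intro x hx
    have h := fixedIdeal_le_ker R ((Algebra.TensorProduct.lift
      ((Algebra.TensorProduct.includeLeft :
        SLRing R ⧸ fixedIdeal R →ₐ[R] (SLRing R ⧸ fixedIdeal R) ⊗[R] (SLRing R ⧸ fixedIdeal R)).comp
        (Ideal.Quotient.mkₐ R (fixedIdeal R)))
      ((Algebra.TensorProduct.includeRight :
        SLRing R ⧸ fixedIdeal R →ₐ[R] (SLRing R ⧸ fixedIdeal R) ⊗[R] (SLRing R ⧸ fixedIdeal R)).comp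
        (Ideal.Quotient.mkₐ R (fixedIdeal R))) fun _ _ ↦ Commute.all _ _).comp
      (Bialgebra.comulAlgHom R (SLRing R))) (by
        rw [SLRing.map_gen_lift_comul, twist_mul, twist_map_gen, twist_map_gen]
        · intro x hx
          simp [RingHom.mem_ker, Ideal.Quotient.eq_zero_iff_mem.mpr hx]
        · intro x hx
          simp [RingHom.mem_ker, Ideal.Quotient.eq_zero_iff_mem.mpr hx])
    have e : ∀ y : SLRing R ⊗[R] SLRing R, (Algebra.TensorProduct.lift
      ((Algebra.TensorProduct.includeLeft :
        SLRing R ⧸ fixedIdeal R →ₐ[R] (SLRing R ⧸ fixedIdeal R) ⊗[R] (SLRing R ⧸ fixedIdeal R)).comp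
        (Ideal.Quotient.mkₐ R (fixedIdeal R)))
      ((Algebra.TensorProduct.includeRight :
        SLRing R ⧸ fixedIdeal R →ₐ[R] (SLRing R ⧸ fixedIdeal R) ⊗[R] (SLRing R ⧸ fixedIdeal R)).comp
        (Ideal.Quotient.mkₐ R (fixedIdeal R))) fun _ _ ↦ Commute.all _ _) y =
      TensorProduct.map ((fixedIdeal R).restrictScalars R).mkQ
        ((fixedIdeal R).restrictScalars R).mkQ y := by
      intro y
      induction y with
      | zero => simp only [map_zero]; rfl
      | add a b ha hb => rw [map_add, map_add, ha, hb]; rfl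
      | tmul a b =>
        rw [Algebra.TensorProduct.lift_tmul, TensorProduct.map_tmul]
        simp only [AlgHom.comp_apply, Algebra.TensorProduct.includeLeft_apply,
          Algebra.TensorProduct.includeRight_apply, Algebra.TensorProduct.tmul_mul_tmul,
          one_mul, mul_one]
        rfl
    exact (e _).symm.trans (h hx)
  antipode_mem := by
    intro x hx
    have h := fixedIdeal_le_ker R ((Ideal.Quotient.mkₐ R (fixedIdeal R)).comp
      (SLRing.antipodeHom R)) (by
        rw [SLRing.map_gen_comp, SLRing.map_gen_antipode, SLRing.map_inv',
          twist_inv (SLRing.det_map_gen R _), twist_map_gen R _ (ker_mk_fixedIdeal R)])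
    exact Ideal.Quotient.eq_zero_iff_mem.mp (h hx)

/-- The coordinate ring of the fixed-point group scheme `(SL_{3,R})^{ℤ/2ℤ}`. -/
def FixedRing : Type u := SLRing R ⧸ fixedIdeal R

namespace FixedRing

instance instCommRing : CommRing (FixedRing R) :=
  inferInstanceAs (CommRing (SLRing R ⧸ fixedIdeal R))

instance instHopfAlgebra : HopfAlgebra R (FixedRing R) :=
  inferInstanceAs (HopfAlgebra R (SLRing R ⧸ fixedIdeal R))

/-- The quotient map, dual to the inclusion of the fixed points in `SL_3`. -/
def mk : SLRing R →ₐ[R] FixedRing R := Ideal.Quotient.mkₐ R (fixedIdeal R)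

/-- The universal matrix of determinant one fixed by `M ↦ J ᵗM⁻¹ J`. -/
def gen : Matrix (Fin 3) (Fin 3) (FixedRing R) := (SLRing.gen R).map (mk R)

theorem det_gen : (gen R).det = 1 := SLRing.det_map_gen R _

theorem twist_gen : twist (gen R) = gen R := twist_map_gen R (mk R) (ker_mk_fixedIdeal R)

variable {R}

/-- A fixed matrix of determinant one in an `R`-algebra `A` is an `A`-valued point of the
fixed-point scheme. -/
def lift {A : Type*} [CommRing A] [Algebra R A] (M : Matrix (Fin 3) (Fin 3) A)
    (hM : M.det = 1) (hM' : twist M = M) : FixedRing R →ₐ[R] A :=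
  Ideal.Quotient.liftₐ (fixedIdeal R) (SLRing.lift M hM) fun a ha ↦
    fixedIdeal_le_ker R (SLRing.lift M hM) (by rw [SLRing.map_gen_lift, hM']) ha

theorem map_gen_lift {A : Type*} [CommRing A] [Algebra R A] (M : Matrix (Fin 3) (Fin 3) A)
    (hM : M.det = 1) (hM' : twist M = M) : (gen R).map (lift (R := R) M hM hM') = M :=
  SLRing.map_gen_lift M hM

theorem hom_ext {A : Type*} [CommRing A] [Algebra R A] {f g : FixedRing R →ₐ[R] A}
    (h : (gen R).map f = (gen R).map g) : f = g :=
  Ideal.Quotient.algHom_ext R (SLRing.hom_ext h)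

theorem ringHom_ext {A : Type*} [CommRing A] {f g : FixedRing R →+* A}
    (h₁ : f.comp (algebraMap R (FixedRing R)) = g.comp (algebraMap R (FixedRing R)))
    (h₂ : (gen R).map f = (gen R).map g) : f = g := by
  let _ : Algebra R A := (f.comp (algebraMap R (FixedRing R))).toAlgebra
  let f' : FixedRing R →ₐ[R] A := { f with commutes' := fun _ ↦ rfl }
  let g' : FixedRing R →ₐ[R] A :=
    { g with commutes' := fun r ↦ (DFunLike.congr_fun h₁ r).symm }
  have : f' = g' := hom_ext h₂
  ext x
  exact DFunLike.congr_fun this x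

/-- The version of `lift` for an unbundled structure map `f : R → A`. -/
def liftRingHom {A : Type*} [CommRing A] (f : R →+* A) (M : Matrix (Fin 3) (Fin 3) A)
    (hM : M.det = 1) (hM' : twist M = M) : FixedRing R →+* A :=
  letI : Algebra R A := f.toAlgebra
  (lift (R := R) M hM hM' : FixedRing R →+* A)

theorem map_gen_liftRingHom {A : Type*} [CommRing A] (f : R →+* A)
    (M : Matrix (Fin 3) (Fin 3) A) (hM : M.det = 1) (hM' : twist M = M) :
    (gen R).map (liftRingHom f M hM hM') = M :=
  let _ : Algebra R A := f.toAlgebra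
  map_gen_lift (R := R) M hM hM'

theorem liftRingHom_comp_algebraMap {A : Type*} [CommRing A] (f : R →+* A)
    (M : Matrix (Fin 3) (Fin 3) A) (hM : M.det = 1) (hM' : twist M = M) :
    (liftRingHom f M hM hM').comp (algebraMap R (FixedRing R)) = f :=
  let _ : Algebra R A := f.toAlgebra
  (lift (R := R) M hM hM').comp_algebraMap

/-- The homomorphism of coordinate rings induced by a change of base rings; it sends the
universal fixed matrix over `R` to the universal fixed matrix over `S`. -/
def baseMap {S : Type u} [CommRing S] (φ : R →+* S) : FixedRing R →+* FixedRing S :=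
  liftRingHom ((algebraMap S (FixedRing S)).comp φ) (gen S) (det_gen S) (twist_gen S)

theorem map_gen_baseMap {S : Type u} [CommRing S] (φ : R →+* S) :
    (gen R).map (baseMap φ) = gen S :=
  map_gen_liftRingHom _ _ _ _

theorem baseMap_comp_algebraMap {S : Type u} [CommRing S] (φ : R →+* S) :
    (baseMap φ).comp (algebraMap R (FixedRing R)) = (algebraMap S (FixedRing S)).comp φ :=
  liftRingHom_comp_algebraMap _ _ _ _

theorem isPushout {S : Type u} [CommRing S] (φ : R →+* S) :
    IsPushout (CommRingCat.ofHom (algebraMap R (FixedRing R))) (CommRingCat.ofHom φ)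
      (CommRingCat.ofHom (baseMap φ)) (CommRingCat.ofHom (algebraMap S (FixedRing S))) := by
  have w : CommRingCat.ofHom (algebraMap R (FixedRing R)) ≫ CommRingCat.ofHom (baseMap φ) =
      CommRingCat.ofHom φ ≫ CommRingCat.ofHom (algebraMap S (FixedRing S)) := by
    rw [← CommRingCat.ofHom_comp, ← CommRingCat.ofHom_comp, baseMap_comp_algebraMap]
  refine ⟨⟨w⟩, ⟨PushoutCocone.IsColimit.mk w
    (fun s ↦ CommRingCat.ofHom (liftRingHom s.inr.hom ((gen R).map s.inl.hom)
      (SLRing.det_map _ (det_gen R)) (by rw [← map_twist _ (det_gen R), twist_gen]))) ?_ ?_ ?_⟩⟩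
  · intro s
    ext1
    refine ringHom_ext ?_ ?_
    · rw [CommRingCat.hom_comp, CommRingCat.hom_ofHom, CommRingCat.hom_ofHom, RingHom.comp_assoc,
        baseMap_comp_algebraMap, ← RingHom.comp_assoc, liftRingHom_comp_algebraMap]
      exact congrArg CommRingCat.Hom.hom s.condition.symm
    · refine Eq.trans ?_ (map_gen_liftRingHom s.inr.hom ((gen R).map s.inl.hom)
        (SLRing.det_map _ (det_gen R)) (by rw [← map_twist _ (det_gen R), twist_gen]))
      rw [← map_gen_baseMap φ, Matrix.map_map]
      rfl
  · intro s
    ext1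
    exact liftRingHom_comp_algebraMap ..
  · intro s m h₁ h₂
    ext1
    refine ringHom_ext ?_ ?_
    · rw [CommRingCat.hom_ofHom, liftRingHom_comp_algebraMap, ← h₂]
      rfl
    · rw [CommRingCat.hom_ofHom, map_gen_liftRingHom, ← h₁, ← map_gen_baseMap φ, Matrix.map_map]
      rfl

end FixedRing

end Fixed

/-- The affine group scheme `(SL_{3,R})^{ℤ/2ℤ}` over `Spec R`. -/
def SL3Fixed (R : Type u) [CommRing R] : Grp (Over (Spec (.of R))) :=
  (hopfSpec (.of R)).obj (.op (.of R (FixedRing R)))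

theorem SL3Fixed.isPullback {R S : Type u} [CommRing R] [CommRing S] (φ : R →+* S) :
    IsPullback (C := Scheme.{u}) (Spec.map (CommRingCat.ofHom (FixedRing.baseMap φ)))
      (SL3Fixed S).X.hom (SL3Fixed R).X.hom (Spec.map (CommRingCat.ofHom φ)) :=
  isPullback_SpecMap_of_isPushout _ _ _ _ (FixedRing.isPushout φ)

/-- The canonical identification of the base change of `(SL_{3,R})^{ℤ/2ℤ}` along
`Spec S ⟶ Spec R` with `(SL_{3,S})^{ℤ/2ℤ}`. -/
def SL3Fixed.baseChangeIso {R S : Type u} [CommRing R] [CommRing S] (φ : R →+* S) :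
    (Over.pullback (Spec.map (CommRingCat.ofHom φ))).obj (SL3Fixed R).X ≅ (SL3Fixed S).X :=
  Over.isoMk (SL3Fixed.isPullback φ).isoPullback.symm (SL3Fixed.isPullback φ).isoPullback_inv_snd

/-- The restriction to `Spec 𝔽₂` of a morphism `π : H ⟶ (SL_{3,ℤ₂})^{ℤ/2ℤ}`: the base change
of `π` along `Spec 𝔽₂ ⟶ Spec ℤ₂`, with target identified with `(SL_{3,𝔽₂})^{ℤ/2ℤ}`. -/
def specialFiber {H : Grp (Over (Spec (.of ℤ_[2])))} (π : H ⟶ SL3Fixed ℤ_[2]) :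
    (Over.pullback (Spec.map (CommRingCat.ofHom (PadicInt.toZMod (p := 2))))).obj H.X ⟶
      (SL3Fixed (ZMod 2)).X :=
  (Over.pullback (Spec.map (CommRingCat.ofHom (PadicInt.toZMod (p := 2))))).map π.hom.hom ≫
    (SL3Fixed.baseChangeIso PadicInt.toZMod).hom

end SLFix

end

noncomputable section

namespace SLFix

/-! Write `a = M 0 1` and `b = M 2 1`. Over `𝔽₂` the fixed-point scheme contains `SL_2` as the block
matrices, and its coordinate ring is spanned by `1, a, b, ab` over the functions on `SL_2`, with `a²
= b² = 0` (`entry_relations`, `exists_expansion`). Let `N` be the kernel of the map on coordinate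
rings dual to the special fibre of `π`. Surjectivity makes `N` nilpotent, and compatibility with
multiplication makes its zero locus closed under products (`isMultiplicative_ker`). Since `SL_2` is
integral, that locus contains `SL_2`, so it can be translated by points of `SL_2`.

These constraints leave two cases (`eq_bot_or_gen_mem`): `N = 0`, or `a ∈ N`. The second contradicts
flatness. Over `ℤ₂` the relation `a² = 2 * M 0 0 * M 0 2` holds; if `a` becomes `2b'` in the flat
ring of `H`, then `M 0 0 * M 0 2 = 2b'²`. Hence `M 0 0 * M 0 2` lies in `N` and is nilpotent,
although it equals `1` at a unipotent point of `SL_2` (`gen_zero_one_notMem_ker`). So `N = 0`, which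
says that the schematic image is everything. -/

/-! ### Fixed matrices as isometries of `J`. -/

theorem transpose_J (A : Type*) [CommRing A] : (J A)ᵀ = J A := by
  ext i j
  fin_cases i <;> fin_cases j <;> simp [J]

/-- Fixed matrices are isometries of the bilinear form `J`. -/
theorem mul_J_mul_transpose {A : Type*} [CommRing A] {M : Matrix (Fin 3) (Fin 3) A}
    (hM : M.det = 1) (h : twist M = M) : M * J A * Mᵀ = J A := by
  have h1 : (M⁻¹)ᵀ * Mᵀ = 1 := by
    rw [← Matrix.transpose_mul, Matrix.mul_nonsing_inv _ (by simp [hM]), Matrix.transpose_one]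
  calc M * J A * Mᵀ = twist M * J A * Mᵀ := by rw [h]
    _ = J A * (M⁻¹)ᵀ * (J A * J A) * Mᵀ := by simp only [twist, Matrix.mul_assoc]
    _ = J A * ((M⁻¹)ᵀ * Mᵀ) := by rw [J_mul_J, mul_one, Matrix.mul_assoc]
    _ = J A := by rw [h1, mul_one]

theorem transpose_mul_J_mul {A : Type*} [CommRing A] {M : Matrix (Fin 3) (Fin 3) A}
    (hM : M.det = 1) (h : twist M = M) : Mᵀ * J A * M = J A := by
  have h1 : Mᵀ * (M⁻¹)ᵀ = 1 := by
    rw [← Matrix.transpose_mul, Matrix.nonsing_inv_mul _ (by simp [hM]), Matrix.transpose_one]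
  calc Mᵀ * J A * M = Mᵀ * J A * twist M := by rw [h]
    _ = Mᵀ * (J A * J A) * (M⁻¹)ᵀ * J A := by simp only [twist, Matrix.mul_assoc]
    _ = J A := by rw [J_mul_J, mul_one, h1, one_mul]

theorem twist_eq_self {A : Type*} [CommRing A] {M : Matrix (Fin 3) (Fin 3) A}
    (h : M * J A * Mᵀ = J A) : twist M = M := by
  have h1 : M * (J A * Mᵀ * J A) = 1 := by
    rw [← Matrix.mul_assoc, ← Matrix.mul_assoc, h, J_mul_J]
  have h2 : M⁻¹ = J A * Mᵀ * J A := Matrix.inv_eq_right_inv h1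
  rw [twist, h2, Matrix.transpose_mul, Matrix.transpose_mul, transpose_J,
    Matrix.transpose_transpose]
  calc J A * (J A * (M * J A)) * J A = (J A * J A) * M * (J A * J A) := by
        simp only [Matrix.mul_assoc]
    _ = M := by simp [J_mul_J]

/-- The matrix of the linear map that fixes the middle basis vector and acts on the outer two
through the given `2 × 2` matrix. -/
def block {A : Type*} [CommRing A] (p q r s : A) : Matrix (Fin 3) (Fin 3) A :=
  !![p, 0, q; 0, 1, 0; r, 0, s]

theorem map_block {A B : Type*} [CommRing A] [CommRing B] (f : A →+* B) (p q r s : A) :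
    (block p q r s).map f = block (f p) (f q) (f r) (f s) := by
  ext i j
  fin_cases i <;> fin_cases j <;> simp [block]

theorem det_block {A : Type*} [CommRing A] {p q r s : A} (h : p * s - q * r = 1) :
    (block p q r s).det = 1 := by
  simp [block, Matrix.det_fin_three]
  linear_combination h

/-! ### Matrix entries in characteristic two. -/

section CharTwo

variable {A : Type*} [CommRing A]

/-- On the outer two coordinates `J` becomes, in characteristic two, the standard alternating form,
which every `2 × 2` matrix of determinant one preserves. -/
theorem twist_block (h2 : (2 : A) = 0) {p q r s : A} (h : p * s - q * r = 1) :
    twist (block p q r s) = block p q r s := by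
  apply twist_eq_self
  ext i j
  fin_cases i <;> fin_cases j <;>
    simp [block, J, Matrix.mul_apply, Fin.sum_univ_three]
  · linear_combination (-p * q) * h2
  · linear_combination -h - q * r * h2
  · linear_combination -h - q * r * h2
  · linear_combination (-r * s) * h2

/-- The diagonal entries of `M J ᵗM = J` express `a²` and `b²` as multiples of `2`. The off-diagonal
ones give the outer minor and, once `M 1 1` is known to be a unit, the remaining middle-row entries.
-/
theorem entry_relations (h2 : (2 : A) = 0) {M : Matrix (Fin 3) (Fin 3) A} (hM : M.det = 1)
    (h : twist M = M) :
    M 0 1 * M 0 1 = 0 ∧ M 2 1 * M 2 1 = 0 ∧ M 1 1 = 1 + M 0 1 * M 2 1 ∧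
      M 1 0 = M 0 0 * M 2 1 + M 2 0 * M 0 1 ∧ M 1 2 = M 0 1 * M 2 2 + M 2 1 * M 0 2 ∧
      M 0 0 * M 2 2 - M 0 2 * M 2 0 = 1 + M 0 1 * M 2 1 := by
  have h00 := congrFun₂ (mul_J_mul_transpose hM h) 0 0
  have h01 := congrFun₂ (mul_J_mul_transpose hM h) 0 1
  have h02 := congrFun₂ (mul_J_mul_transpose hM h) 0 2
  have h12 := congrFun₂ (mul_J_mul_transpose hM h) 1 2
  have h22 := congrFun₂ (mul_J_mul_transpose hM h) 2 2
  have g01 := congrFun₂ (transpose_mul_J_mul hM h) 0 1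
  have g12 := congrFun₂ (transpose_mul_J_mul hM h) 1 2
  simp [J, Matrix.mul_apply, Fin.sum_univ_three] at h00 h01 h02 h12 h22 g01 g12
  rw [Matrix.det_fin_three] at hM
  generalize M 0 0 = x at *
  generalize M 0 1 = a at *
  generalize M 0 2 = y at *
  generalize M 1 0 = c at *
  generalize M 1 1 = e at *
  generalize M 1 2 = d at *
  generalize M 2 0 = z at *
  generalize M 2 1 = b at *
  generalize M 2 2 = w at *
  have ha : a * a = 0 := by grind
  have hb : b * b = 0 := by grind
  have hdet : x * w - y * z = 1 + a * b := by grind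
  -- In the determinant the terms through `c` and `d` are equal to each other by `g01` and `g12`, so
  -- they cancel; `1 + a * b` is its own inverse.
  have he : e * (1 + a * b) = 1 := by grind
  have he1 : e = 1 + a * b := by grind
  exact ⟨ha, hb, he1, by grind, by grind, hdet⟩

variable (A) in
theorem two_eq_zero_of_algebra [Algebra (ZMod 2) A] : (2 : A) = 0 := by
  have h := map_ofNat (algebraMap (ZMod 2) A) 2
  rwa [show (OfNat.ofNat 2 : ZMod 2) = 0 from rfl, map_zero, eq_comm] at h

end CharTwo

/-! ### The group `SL_2` over `𝔽₂` and its integrality. -/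

/-- The polynomial `det - 1` for the generic `2 × 2` matrix, with the variables numbered row by
row. -/
def detSubOne : MvPolynomial (Fin 4) (ZMod 2) :=
  .X 0 * .X 3 - .X 1 * .X 2 - 1

/-- The polynomial has degree one in the last variable, and its two coefficients are coprime. -/
theorem irreducible_detSubOne : Irreducible detSubOne := by
  have h : detSubOne = .X 0 * .X 3 + (-(.X 1 * .X 2) - 1) := by
    rw [detSubOne]; ring
  have hX : ∀ i : Fin 4, (MvPolynomial.X i : MvPolynomial (Fin 4) (ZMod 2)).vars = {i} :=
    fun i ↦ MvPolynomial.vars_X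
  rw [h]
  refine MvPolynomial.irreducible_mul_X_add _ _ 3 (MvPolynomial.X_ne_zero 0) (by simp) ?_ ?_
  · intro h3
    have h4 := MvPolynomial.vars_sub_subset _ h3
    rw [MvPolynomial.vars_neg, MvPolynomial.vars_one, Finset.union_empty] at h4
    have := MvPolynomial.vars_mul _ _ h4
    simp [hX] at this
  · refine MvPolynomial.X_prime.irreducible.isRelPrime_iff_not_dvd.mpr fun ⟨c, hc⟩ ↦ ?_
    -- At the origin `X 0` vanishes while the constant coefficient does not.
    have := congrArg (MvPolynomial.aeval (fun _ : Fin 4 ↦ (0 : ZMod 2))) hc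
    simp at this

/-- The coordinate ring of `SL_2` over `𝔽₂`. -/
def SL2Ring : Type := MvPolynomial (Fin 4) (ZMod 2) ⧸ Ideal.span {detSubOne}

namespace SL2Ring

instance : CommRing SL2Ring :=
  inferInstanceAs (CommRing (MvPolynomial (Fin 4) (ZMod 2) ⧸ Ideal.span {detSubOne}))

instance : Algebra (ZMod 2) SL2Ring :=
  inferInstanceAs (Algebra (ZMod 2) (MvPolynomial (Fin 4) (ZMod 2) ⧸ Ideal.span {detSubOne}))

instance : IsDomain SL2Ring :=
  have : (Ideal.span {detSubOne}).IsPrime :=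
    (Ideal.span_singleton_prime irreducible_detSubOne.ne_zero).mpr irreducible_detSubOne.prime
  inferInstanceAs (IsDomain (MvPolynomial (Fin 4) (ZMod 2) ⧸ Ideal.span {detSubOne}))

/-- The coordinate functions on `SL_2`. -/
def coord (i : Fin 4) : SL2Ring := Ideal.Quotient.mk (Ideal.span {detSubOne}) (.X i)

theorem det_coord : coord 0 * coord 3 - coord 1 * coord 2 = 1 := by
  have h : Ideal.Quotient.mk (Ideal.span {detSubOne}) detSubOne = 0 :=
    Ideal.Quotient.eq_zero_iff_mem.mpr (Ideal.subset_span rfl)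
  rw [detSubOne, map_sub, sub_eq_zero, map_sub, map_mul, map_mul, map_one] at h
  exact h

/-- The algebra homomorphism that corresponds to a point of `SL_2`. -/
def lift {A : Type*} [CommRing A] [Algebra (ZMod 2) A] (v : Fin 4 → A)
    (hv : v 0 * v 3 - v 1 * v 2 = 1) : SL2Ring →ₐ[ZMod 2] A :=
  Ideal.Quotient.liftₐ _ (MvPolynomial.aeval v) <| by
    intro a ha
    rw [← RingHom.mem_ker]
    refine (Ideal.span_le.mpr ?_) ha
    rintro _ rfl
    simp [detSubOne, RingHom.mem_ker, hv]

@[simp]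
theorem lift_coord {A : Type*} [CommRing A] [Algebra (ZMod 2) A] (v : Fin 4 → A)
    (hv : v 0 * v 3 - v 1 * v 2 = 1) (i : Fin 4) : lift v hv (coord i) = v i :=
  MvPolynomial.aeval_X v i

theorem hom_ext {A : Type*} [CommRing A] [Algebra (ZMod 2) A] {f g : SL2Ring →ₐ[ZMod 2] A}
    (h : ∀ i, f (coord i) = g (coord i)) : f = g :=
  Ideal.Quotient.algHom_ext _ (MvPolynomial.algHom_ext h)

end SL2Ring

/-! ### Comultiplication and multiplicative ideals. -/

namespace FixedRing

theorem subalgebra_eq_top {R : Type*} [CommRing R] (P : Subalgebra R (FixedRing R))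
    (h : ∀ i j, gen R i j ∈ P) : P = ⊤ := by
  rw [eq_top_iff]
  rintro f -
  obtain ⟨g, rfl⟩ : ∃ g, mk R g = f := Ideal.Quotient.mk_surjective f
  obtain ⟨p, rfl⟩ : ∃ p, SLRing.mk R p = g := Ideal.Quotient.mk_surjective g
  change p ∈ P.comap ((mk R).comp (SLRing.mk R))
  have : Algebra.adjoin R (Set.range MvPolynomial.X) ≤ P.comap ((mk R).comp (SLRing.mk R)) := by
    refine Algebra.adjoin_le ?_
    rintro _ ⟨⟨i, j⟩, rfl⟩
    exact h i j
  exact this (by rw [MvPolynomial.adjoin_range_X]; trivial)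

theorem comul_gen {R : Type*} [CommRing R] (i j : Fin 3) :
    Bialgebra.comulAlgHom R (FixedRing R) (gen R i j) = ∑ k, gen R i k ⊗ₜ[R] gen R k j := by
  have h : Coalgebra.comul (R := R) (gen R i j) =
      TensorProduct.map (mk R).toLinearMap (mk R).toLinearMap
        (SLRing.comulHom R (SLRing.gen R i j)) := rfl
  refine h.trans ?_
  rw [SLRing.comulHom_gen, map_sum]
  rfl

theorem map_gen_lift_comul {R A : Type*} [CommRing R] [CommRing A] [Algebra R A]
    (f g : FixedRing R →ₐ[R] A) :
    (gen R).map ((Algebra.TensorProduct.lift f g fun _ _ ↦ Commute.all _ _).comp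
      (Bialgebra.comulAlgHom R (FixedRing R))) = (gen R).map f * (gen R).map g := by
  ext i j
  rw [Matrix.map_apply, AlgHom.comp_apply, comul_gen]
  simp [Matrix.mul_apply]

/-- An ideal is multiplicative if the points of its zero locus are closed under
multiplication. -/
def IsMultiplicative {R : Type} [CommRing R] (N : Ideal (FixedRing R)) : Prop :=
  ∀ ⦃T : Type⦄ [CommRing T] [Algebra R T] (α β γ : FixedRing R →ₐ[R] T),
    N ≤ RingHom.ker α → N ≤ RingHom.ker β →
    (gen R).map γ = (gen R).map α * (gen R).map β → N ≤ RingHom.ker γ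

/-- The product of two points that kill `N` is the comultiplication followed by a map that factors
through the tensor square of the quotient by `N`. -/
theorem isMultiplicative_of_map_comul {R : Type} [CommRing R] {N : Ideal (FixedRing R)}
    (h : ∀ f ∈ N, Algebra.TensorProduct.map (Ideal.Quotient.mkₐ R N) (Ideal.Quotient.mkₐ R N)
      (Bialgebra.comulAlgHom R (FixedRing R) f) = 0) : IsMultiplicative N := by
  intro T _ _ α β γ hα hβ hγ f hf
  have hγ' : γ = (Algebra.TensorProduct.lift α β fun _ _ ↦ Commute.all _ _).comp
      (Bialgebra.comulAlgHom R (FixedRing R)) := hom_ext (by rw [hγ, map_gen_lift_comul])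
  have hαβ : Algebra.TensorProduct.lift α β (fun _ _ ↦ Commute.all _ _) =
      (Algebra.TensorProduct.lift (Ideal.Quotient.liftₐ N α hα) (Ideal.Quotient.liftₐ N β hβ)
        (fun _ _ ↦ Commute.all _ _)).comp
      (Algebra.TensorProduct.map (Ideal.Quotient.mkₐ R N) (Ideal.Quotient.mkₐ R N)) := by
    ext x <;> simp <;> rfl
  rw [RingHom.mem_ker, hγ', hαβ, AlgHom.comp_apply, AlgHom.comp_apply, h f hf, map_zero]

end FixedRing

theorem tmul_eq_zero {K V W : Type*} [Field K] [AddCommGroup V] [AddCommGroup W] [Module K V]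
    [Module K W] {v : V} {w : W} (h : v ⊗ₜ[K] w = 0) : v = 0 ∨ w = 0 := by
  by_contra! hvw
  refine hvw.1 ((Module.forall_dual_apply_eq_zero_iff K v).mp fun φ ↦ ?_)
  have := congrArg (fun x ↦ TensorProduct.lid K W (φ.rTensor W x)) h
  simpa [hvw.2] using this

/-! ### The special fibre as `SL_2` times an infinitesimal factor. -/

namespace FixedRing

theorem exists_algHom {R T : Type*} [CommRing R] [CommRing T] [Algebra R T]
    (α β : FixedRing R →ₐ[R] T) :
    ∃ γ : FixedRing R →ₐ[R] T, (gen R).map γ = (gen R).map α * (gen R).map β :=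
  ⟨_, map_gen_lift_comul α β⟩

theorem gen_relations : let M := gen (ZMod 2)
    M 0 1 * M 0 1 = 0 ∧ M 2 1 * M 2 1 = 0 ∧ M 1 1 = 1 + M 0 1 * M 2 1 ∧
      M 1 0 = M 0 0 * M 2 1 + M 2 0 * M 0 1 ∧ M 1 2 = M 0 1 * M 2 2 + M 2 1 * M 0 2 ∧
      M 0 0 * M 2 2 - M 0 2 * M 2 0 = 1 + M 0 1 * M 2 1 :=
  entry_relations (two_eq_zero_of_algebra _) (det_gen _) (twist_gen _)

/-- The point of the fixed-point scheme in characteristic two given by a point of `SL_2`. -/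
def blockHom {T : Type*} [CommRing T] [Algebra (ZMod 2) T] {p q r s : T}
    (h : p * s - q * r = 1) : FixedRing (ZMod 2) →ₐ[ZMod 2] T :=
  lift (block p q r s) (det_block h) (twist_block (two_eq_zero_of_algebra T) h)

theorem map_gen_blockHom {T : Type*} [CommRing T] [Algebra (ZMod 2) T] {p q r s : T}
    (h : p * s - q * r = 1) : (gen (ZMod 2)).map (blockHom h) = block p q r s :=
  map_gen_lift _ _ _

/-- Every point of `SL_2` factors through the universal one, whose ring is a domain and therefore
kills nilpotents. -/
theorem le_ker_blockHom {N : Ideal (FixedRing (ZMod 2))} (hN : N ≤ nilradical _)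
    {T : Type*} [CommRing T] [Algebra (ZMod 2) T] {p q r s : T} (h : p * s - q * r = 1) :
    N ≤ RingHom.ker (blockHom h) := by
  let ρ : SL2Ring →ₐ[ZMod 2] T := SL2Ring.lift ![p, q, r, s] h
  have hc (i : Fin 4) : ρ (.coord i) = ![p, q, r, s] i := SL2Ring.lift_coord _ _ i
  have hρ : blockHom h = ρ.comp (blockHom SL2Ring.det_coord) := by
    apply hom_ext
    have e : (gen (ZMod 2)).map (ρ.comp (blockHom SL2Ring.det_coord)) =
        ((gen (ZMod 2)).map (blockHom SL2Ring.det_coord)).map (ρ : SL2Ring →+* T) := by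
      ext i j; simp
    rw [e, map_gen_blockHom, map_gen_blockHom, map_block]
    simp [hc]
  intro f hf
  have : blockHom SL2Ring.det_coord f = 0 := ((mem_nilradical.mp (hN hf)).map _).eq_zero
  rw [RingHom.mem_ker, hρ, AlgHom.comp_apply, this, map_zero]

/-- The retraction of the fixed-point scheme in characteristic two to `SL_2`. -/
def retraction : SL2Ring →ₐ[ZMod 2] FixedRing (ZMod 2) :=
  let M := gen (ZMod 2)
  SL2Ring.lift ![(1 + M 0 1 * M 2 1) * M 0 0, (1 + M 0 1 * M 2 1) * M 0 2, M 2 0, M 2 2] <| by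
    obtain ⟨ha, hb, -, -, -, hd⟩ := gen_relations
    -- The outer minor is `1 + ab`, whose square is `1`; scaling one row by it restores determinant
    -- one.
    have h2 := two_eq_zero_of_algebra (FixedRing (ZMod 2))
    simp only [Matrix.cons_val]
    grind

theorem retraction_coord (i : Fin 4) : retraction (.coord i) =
    ![(1 + gen _ 0 1 * gen _ 2 1) * gen _ 0 0, (1 + gen _ 0 1 * gen _ 2 1) * gen _ 0 2,
      gen _ 2 0, gen _ 2 2] i := by
  simp [retraction]

/-- Because `a² = b² = 0`, such sums form a subalgebra, so it suffices to expand the nine matrix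
entries. -/
theorem exists_expansion (f : FixedRing (ZMod 2)) : ∃ t₀ t₁ t₂ t₃ : SL2Ring,
    f = retraction t₀ + gen _ 0 1 * retraction t₁ + gen _ 2 1 * retraction t₂ +
      gen _ 0 1 * gen _ 2 1 * retraction t₃ := by
  obtain ⟨ha, hb, he, hc, hd, -⟩ := gen_relations
  have h2 := two_eq_zero_of_algebra (FixedRing (ZMod 2))
  have r0 := retraction_coord 0
  have r1 := retraction_coord 1
  have r2 := retraction_coord 2
  have r3 := retraction_coord 3
  simp only [Matrix.cons_val] at r0 r1 r2 r3
  let P : Subalgebra (ZMod 2) (FixedRing (ZMod 2)) :=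
    { carrier := {f | ∃ t₀ t₁ t₂ t₃ : SL2Ring,
        f = retraction t₀ + gen _ 0 1 * retraction t₁ + gen _ 2 1 * retraction t₂ +
          gen _ 0 1 * gen _ 2 1 * retraction t₃}
      add_mem' := by
        rintro _ _ ⟨t₀, t₁, t₂, t₃, rfl⟩ ⟨u₀, u₁, u₂, u₃, rfl⟩
        refine ⟨t₀ + u₀, t₁ + u₁, t₂ + u₂, t₃ + u₃, ?_⟩
        simp only [map_add]
        ring
      mul_mem' := by
        rintro _ _ ⟨t₀, t₁, t₂, t₃, rfl⟩ ⟨u₀, u₁, u₂, u₃, rfl⟩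
        refine ⟨t₀ * u₀, t₀ * u₁ + t₁ * u₀, t₀ * u₂ + t₂ * u₀,
          t₀ * u₃ + t₁ * u₂ + t₂ * u₁ + t₃ * u₀, ?_⟩
        simp only [map_add, map_mul]
        grind
      algebraMap_mem' := fun c ↦ ⟨algebraMap _ _ c, 0, 0, 0, by simp⟩ }
  suffices h : P = ⊤ from (h ▸ Algebra.mem_top : f ∈ P)
  refine subalgebra_eq_top P fun i j ↦ ?_
  fin_cases i <;> fin_cases j
  · exact ⟨.coord 0, 0, 0, .coord 0, by simp [r0]; grind⟩
  · exact ⟨0, 1, 0, 0, by simp⟩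
  · exact ⟨.coord 1, 0, 0, .coord 1, by simp [r1]; grind⟩
  · exact ⟨0, .coord 2, .coord 0, 0, by simp [r0, r2]; grind⟩
  · exact ⟨1, 0, 0, 1, by simp [he]⟩
  · exact ⟨0, .coord 3, .coord 1, 0, by simp [r1, r3]; grind⟩
  · exact ⟨.coord 2, 0, 0, 0, by simp [r2]⟩
  · exact ⟨0, 0, 1, 0, by simp⟩
  · exact ⟨.coord 3, 0, 0, 0, by simp [r3]⟩

/-! ### The dichotomy for nilpotent multiplicative ideals. -/

variable {N : Ideal (FixedRing (ZMod 2))} {T : Type} [CommRing T] [Algebra (ZMod 2) T]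

/-- The product `α g β` kills `ab` for every `g` in `SL_2`. Expanding this gives a relation linear
in the entries of `g`, and varying `g` separates its terms. -/
theorem mul_eq_zero_of_mul_mem (hN : N ≤ nilradical _) (hm : IsMultiplicative N)
    (h : gen _ 0 1 * gen _ 2 1 ∈ N) {α β : FixedRing (ZMod 2) →ₐ[ZMod 2] T}
    (hα : N ≤ RingHom.ker α) (hβ : N ≤ RingHom.ker β) :
    α (gen _ 1 0) * β (gen _ 0 1) = 0 ∧ α (gen _ 1 2) * β (gen _ 0 1) = 0 := by
  have h2 := two_eq_zero_of_algebra T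
  obtain ⟨ha, hb, he, hc, hd, -⟩ := gen_relations
  have key (p q r s : T) (hpq : p * s - q * r = 1) :
      (p * α (gen _ 1 0) + r * α (gen _ 1 2)) * β (gen _ 0 1) +
        (q * α (gen _ 1 0) + s * α (gen _ 1 2)) * β (gen _ 2 1) = 0 := by
    obtain ⟨γ, hγ⟩ := exists_algHom α (blockHom hpq)
    obtain ⟨δ, hδ⟩ := exists_algHom γ β
    have hδN := hm _ _ _ (hm _ _ _ hα (le_ker_blockHom hN hpq) hγ) hβ hδ h
    rw [hγ, map_gen_blockHom] at hδ
    have h01 := congrFun₂ hδ 0 1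
    have h21 := congrFun₂ hδ 2 1
    simp only [block, Matrix.mul_apply, Fin.sum_univ_three, Matrix.map_apply, Matrix.of_apply,
      Matrix.cons_val, mul_zero, mul_one, add_zero, zero_add] at h01 h21
    rw [RingHom.mem_ker, map_mul, h01, h21] at hδN
    have hαh := RingHom.mem_ker.mp (hα h)
    have hβh := RingHom.mem_ker.mp (hβ h)
    have hβa := congrArg β ha
    have hβb := congrArg β hb
    rw [hc, hd]
    rw [he] at hδN
    simp only [map_mul, map_add, map_one, map_zero] at hδN hαh hβh hβa hβb ⊢
    grind
  -- Four elements of `SL_2(𝔽₂)` suffice to isolate the terms; the last has determinant `-1 = 1`.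
  have k1 := key 1 0 0 1 (by ring)
  have k2 := key 1 1 0 1 (by ring)
  have k3 := key 1 0 1 1 (by ring)
  have k4 := key 1 1 1 0 (by linear_combination -h2)
  constructor <;> grind

/-- Right multiplication by a block matrix leaves the middle column unchanged and commutes with the
retraction. The `SL_2` component of a point can thus be moved anywhere with `a` and `b` kept. -/
theorem exists_algHom_comp_retraction (hN : N ≤ nilradical _) (hm : IsMultiplicative N)
    {α : FixedRing (ZMod 2) →ₐ[ZMod 2] T} (hα : N ≤ RingHom.ker α) (ι : SL2Ring →ₐ[ZMod 2] T) :
    ∃ γ : FixedRing (ZMod 2) →ₐ[ZMod 2] T, N ≤ RingHom.ker γ ∧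
      γ (gen _ 0 1) = α (gen _ 0 1) ∧ γ (gen _ 2 1) = α (gen _ 2 1) ∧
      γ.comp retraction = ι := by
  have h2 := two_eq_zero_of_algebra T
  obtain ⟨ha, hb, -, -, -, hdet⟩ := gen_relations
  have hαa := congrArg α ha
  have hαb := congrArg α hb
  have hαd := congrArg α hdet
  have hιd := congrArg ι SL2Ring.det_coord
  simp only [map_mul, map_add, map_sub, map_one, map_zero] at hαa hαb hαd hιd
  have hu : (1 + α (gen _ 0 1) * α (gen _ 2 1)) * (1 + α (gen _ 0 1) * α (gen _ 2 1)) = 1 := by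
    grind
  have hr (i : Fin 4) : α (retraction (.coord i)) =
      ![(1 + α (gen _ 0 1) * α (gen _ 2 1)) * α (gen _ 0 0),
        (1 + α (gen _ 0 1) * α (gen _ 2 1)) * α (gen _ 0 2), α (gen _ 2 0), α (gen _ 2 2)] i := by
    rw [retraction_coord]
    fin_cases i <;> simp
  -- multiply by the inverse of the retraction of `α`, then by `ι`
  have hpq : (α (retraction (.coord 3)) * ι (.coord 0) -
        α (retraction (.coord 1)) * ι (.coord 2)) *
      (α (retraction (.coord 0)) * ι (.coord 3) - α (retraction (.coord 2)) * ι (.coord 1)) -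
      (α (retraction (.coord 3)) * ι (.coord 1) - α (retraction (.coord 1)) * ι (.coord 3)) *
      (α (retraction (.coord 0)) * ι (.coord 2) - α (retraction (.coord 2)) * ι (.coord 0)) =
      1 := by
    have hd := congrArg (fun t ↦ α (retraction t)) SL2Ring.det_coord
    simp only [map_mul, map_sub, map_one] at hd
    linear_combination hd * (ι (.coord 0) * ι (.coord 3) - ι (.coord 1) * ι (.coord 2)) + hιd
  obtain ⟨γ, hγ⟩ := exists_algHom α (blockHom hpq)
  refine ⟨γ, hm _ _ _ hα (le_ker_blockHom hN hpq) hγ, ?_⟩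
  rw [map_gen_blockHom] at hγ
  have e00 := congrFun₂ hγ 0 0
  have e01 := congrFun₂ hγ 0 1
  have e02 := congrFun₂ hγ 0 2
  have e20 := congrFun₂ hγ 2 0
  have e21 := congrFun₂ hγ 2 1
  have e22 := congrFun₂ hγ 2 2
  simp only [block, Matrix.mul_apply, Fin.sum_univ_three, Matrix.map_apply, Matrix.of_apply,
    Matrix.cons_val, mul_zero, mul_one, add_zero, zero_add, hr] at e00 e01 e02 e20 e21 e22
  refine ⟨e01, e21, SL2Ring.hom_ext fun i ↦ ?_⟩
  rw [AlgHom.comp_apply, retraction_coord]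
  fin_cases i <;>
    simp only [Fin.zero_eta, Fin.mk_one, Fin.reduceFinMk, Matrix.cons_val, map_mul, map_add,
      map_one, e00, e01, e02, e20, e21, e22]
  · linear_combination
      (1 + α (gen _ 0 1) * α (gen _ 2 1)) * ι (.coord 0) * hαd + ι (.coord 0) * hu
  · linear_combination
      (1 + α (gen _ 0 1) * α (gen _ 2 1)) * ι (.coord 1) * hαd + ι (.coord 1) * hu
  · linear_combination
      (1 + α (gen _ 0 1) * α (gen _ 2 1)) * ι (.coord 2) * hαd + ι (.coord 2) * hu
  · linear_combination
      (1 + α (gen _ 0 1) * α (gen _ 2 1)) * ι (.coord 3) * hαd + ι (.coord 3) * hu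

theorem le_ker_comp {Q T : Type*} [CommRing Q] [Algebra (ZMod 2) Q] [CommRing T]
    [Algebra (ZMod 2) T] {f : FixedRing (ZMod 2) →ₐ[ZMod 2] Q} (hf : N ≤ RingHom.ker f)
    (g : Q →ₐ[ZMod 2] T) : N ≤ RingHom.ker (g.comp f) := fun x hx ↦ by
  rw [RingHom.mem_ker, AlgHom.comp_apply, RingHom.mem_ker.mp (hf hx), map_zero]

/-- For the two universal points modulo `N`, the preceding vanishing concerns pure tensors over a
field: either `a` vanishes modulo `N`, or `M 1 0` and `M 1 2` both do, and these generate `a`. -/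
theorem gen_zero_one_mem (hN : N ≤ nilradical _) (hm : IsMultiplicative N)
    (h : gen _ 0 1 * gen _ 2 1 ∈ N) : gen _ 0 1 ∈ N := by
  let mkN := Ideal.Quotient.mkₐ (ZMod 2) N
  have hmk : N ≤ RingHom.ker mkN := fun x hx ↦ Ideal.Quotient.eq_zero_iff_mem.mpr hx
  obtain ⟨hca, hda⟩ := mul_eq_zero_of_mul_mem hN hm h
    (le_ker_comp hmk (Algebra.TensorProduct.includeLeft (S := ZMod 2) (B := _ ⧸ N)))
    (le_ker_comp hmk (Algebra.TensorProduct.includeRight (A := _ ⧸ N)))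
  simp only [AlgHom.comp_apply, Algebra.TensorProduct.includeLeft_apply,
    Algebra.TensorProduct.includeRight_apply, Algebra.TensorProduct.tmul_mul_tmul, one_mul,
    mul_one] at hca hda
  refine Ideal.Quotient.eq_zero_iff_mem.mp (?_ : mkN (gen _ 0 1) = 0)
  rcases tmul_eq_zero hca with hc0 | ha0
  swap
  · exact ha0
  rcases tmul_eq_zero hda with hd0 | ha0
  swap
  · exact ha0
  have h2 := two_eq_zero_of_algebra (FixedRing (ZMod 2))
  obtain ⟨ha, hb, -, hc, hd, hdet⟩ := gen_relations
  have e : gen (ZMod 2) 0 1 = gen _ 0 0 * gen _ 1 2 + gen _ 0 2 * gen _ 1 0 := by grind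
  rw [e, map_add, map_mul, map_mul, hc0, hd0, mul_zero, mul_zero, add_zero]

/-- Translation by the universal point of `SL_2` makes the `SL_2` coordinates independent of `a` and
`b`, so `ab` times a nonzero function on `SL_2` stays nonzero modulo `N`. -/
theorem eq_bot_of_notMem (hN : N ≤ nilradical _) (hm : IsMultiplicative N)
    (h : gen _ 0 1 * gen _ 2 1 ∉ N) : N = ⊥ := by
  let mkN := Ideal.Quotient.mkₐ (ZMod 2) N
  have hmk : N ≤ RingHom.ker mkN := fun x hx ↦ Ideal.Quotient.eq_zero_iff_mem.mpr hx
  have hab : mkN (gen _ 0 1) * mkN (gen _ 2 1) ≠ 0 := fun h' ↦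
    h (Ideal.Quotient.eq_zero_iff_mem.mp h')
  obtain ⟨γ, hγN, ea, eb, hγ⟩ := exists_algHom_comp_retraction hN hm
    (le_ker_comp hmk (Algebra.TensorProduct.includeLeft (S := ZMod 2) (B := SL2Ring)))
    Algebra.TensorProduct.includeRight
  have hγt (t : SL2Ring) : γ (retraction t) = 1 ⊗ₜ t := DFunLike.congr_fun hγ t
  have cancel (t : SL2Ring) (ht : γ (gen _ 0 1 * gen _ 2 1 * retraction t) = 0) : t = 0 := by
    rw [map_mul, map_mul, ea, eb, hγt] at ht
    simp only [AlgHom.comp_apply, Algebra.TensorProduct.includeLeft_apply,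
      Algebra.TensorProduct.tmul_mul_tmul, one_mul, mul_one] at ht
    exact (tmul_eq_zero ht).resolve_left hab
  obtain ⟨ha, hb, -⟩ := gen_relations
  rw [eq_bot_iff]
  intro f hf
  obtain ⟨t₀, t₁, t₂, t₃, hft⟩ := exists_expansion f
  have hmul (g : FixedRing (ZMod 2)) : γ (g * f) = 0 := by
    rw [map_mul, RingHom.mem_ker.mp (hγN hf), mul_zero]
  -- Multiplying by `ab`, `b`, `a` and `1` in turn leaves one unknown coefficient each time,
  -- attached to `ab`.
  have h0 : t₀ = 0 := cancel _ (by
    rw [← hmul (gen _ 0 1 * gen _ 2 1), hft]; congr 1; grind)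
  subst h0
  have h1 : t₁ = 0 := cancel _ (by
    rw [← hmul (gen _ 2 1), hft]; congr 1; simp only [map_zero]; grind)
  subst h1
  have h2 : t₂ = 0 := cancel _ (by
    rw [← hmul (gen _ 0 1), hft]; congr 1; simp only [map_zero]; grind)
  subst h2
  have h3 : t₃ = 0 := cancel _ (by
    rw [← hmul 1, hft]; congr 1; simp only [map_zero]; ring)
  subst h3
  simp [hft]

theorem eq_bot_or_gen_mem (hN : N ≤ nilradical _) (hm : IsMultiplicative N) :
    N = ⊥ ∨ gen _ 0 1 ∈ N := by
  by_cases h : gen _ 0 1 * gen _ 2 1 ∈ N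
  · exact .inr (gen_zero_one_mem hN hm h)
  · exact .inl (eq_bot_of_notMem hN hm h)

theorem baseMap_gen {R S : Type} [CommRing R] [CommRing S] (φ : R →+* S) (i j : Fin 3) :
    baseMap φ (gen R i j) = gen S i j :=
  congrFun₂ (map_gen_baseMap φ) i j

theorem baseMap_surjective {R S : Type} [CommRing R] [CommRing S] {φ : R →+* S}
    (hφ : Function.Surjective φ) : Function.Surjective (baseMap φ) := by
  let P : Subalgebra S (FixedRing S) :=
    { (baseMap φ).range with
      algebraMap_mem' := fun s ↦ by
        obtain ⟨r, rfl⟩ := hφ s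
        exact ⟨algebraMap R _ r, DFunLike.congr_fun (baseMap_comp_algebraMap φ) r⟩ }
  have hP : P = ⊤ := subalgebra_eq_top P fun i j ↦ ⟨gen R i j, baseMap_gen φ i j⟩
  intro f
  exact (hP ▸ Algebra.mem_top : f ∈ P)

end FixedRing

open FixedRing

theorem toZMod_surjective : Function.Surjective (PadicInt.toZMod (p := 2)) :=
  ZMod.ringHom_surjective _

/-! ### Reduction modulo two of a map of bialgebras. -/

section Reduction

variable {B C : Type} [CommRing B] [Bialgebra ℤ_[2] B] [CommRing C] [Algebra (ZMod 2) C]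
  (φ : FixedRing ℤ_[2] →ₐc[ℤ_[2]] B) (q : B →+* C) (ψ : FixedRing (ZMod 2) →ₐ[ZMod 2] C)

/-- No comultiplication on `C` is needed: that of `B` maps to `C ⊗ C` and kills multiples of `2`.
The quotient by the kernel embeds in `C`, and over a field so does its tensor square in `C ⊗ C`. -/
theorem isMultiplicative_ker (hq : ∀ b, q b = 0 → (2 : B) ∣ b)
    (h : (ψ : FixedRing (ZMod 2) →+* C).comp (baseMap PadicInt.toZMod) =
      q.comp (φ : FixedRing ℤ_[2] →+* B)) :
    IsMultiplicative (RingHom.ker ψ) := by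
  have hψ (x : FixedRing ℤ_[2]) : ψ (baseMap PadicInt.toZMod x) = q (φ x) :=
    DFunLike.congr_fun h x
  apply isMultiplicative_of_map_comul
  let Q := FixedRing (ZMod 2) ⧸ RingHom.ker ψ
  let mkN : FixedRing (ZMod 2) →ₐ[ZMod 2] Q := Ideal.Quotient.mkₐ (ZMod 2) (RingHom.ker ψ)
  let j : Q →ₐ[ZMod 2] C := Ideal.kerLiftAlg ψ
  have hj : Function.Injective j := Ideal.kerLiftAlg_injective ψ
  have hjm : j.comp mkN = ψ := by ext; rfl
  have hjj : Function.Injective (Algebra.TensorProduct.map j j) :=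
    TensorProduct.map_injective_of_flat_flat j.toLinearMap j.toLinearMap hj hj
  intro f hf
  apply hjj
  rw [map_zero]
  have hcomp : (Algebra.TensorProduct.map j j).comp (Algebra.TensorProduct.map mkN mkN) =
      Algebra.TensorProduct.map ψ ψ := by
    rw [← Algebra.TensorProduct.map_comp, hjm]
  refine (DFunLike.congr_fun hcomp _).trans ?_
  obtain ⟨x, rfl⟩ := baseMap_surjective toZMod_surjective f
  let _ : Algebra ℤ_[2] (C ⊗[ZMod 2] C) :=
    ((algebraMap (ZMod 2) (C ⊗[ZMod 2] C)).comp PadicInt.toZMod).toAlgebra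
  have hqa (r : ℤ_[2]) : q (algebraMap _ _ r) = algebraMap (ZMod 2) C (PadicInt.toZMod r) := by
    have h1 := DFunLike.congr_fun (baseMap_comp_algebraMap (PadicInt.toZMod (p := 2))) r
    have h2 := hψ (algebraMap _ _ r)
    rw [AlgHomClass.commutes φ] at h2
    rw [← h2, ← AlgHom.commutes ψ]
    exact congrArg ψ h1
  let q₁ : B →ₐ[ℤ_[2]] C ⊗[ZMod 2] C :=
    { (Algebra.TensorProduct.includeLeftRingHom).comp q with
      commutes' := fun r ↦ congrArg Algebra.TensorProduct.includeLeftRingHom (hqa r) }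
  let q₂ : B →ₐ[ℤ_[2]] C ⊗[ZMod 2] C :=
    { (Algebra.TensorProduct.includeRight : C →ₐ[ZMod 2] C ⊗[ZMod 2] C).toRingHom.comp q with
      commutes' := fun r ↦ by
        refine (congrArg (Algebra.TensorProduct.includeRight : C →ₐ[ZMod 2] C ⊗[ZMod 2] C)
          (hqa r)).trans ?_
        exact AlgHom.commutes _ _ }
  let Δ : B →ₐ[ℤ_[2]] C ⊗[ZMod 2] C :=
    (Algebra.TensorProduct.lift q₁ q₂ fun _ _ ↦ Commute.all _ _).comp
      (Bialgebra.comulAlgHom ℤ_[2] B)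
  have hΔ : ((Algebra.TensorProduct.map ψ ψ).comp (Bialgebra.comulAlgHom (ZMod 2) _) :
      FixedRing (ZMod 2) →+* C ⊗[ZMod 2] C).comp (baseMap PadicInt.toZMod) =
      (Δ : B →+* C ⊗[ZMod 2] C).comp (φ : FixedRing ℤ_[2] →+* B) := by
    refine ringHom_ext ?_ ?_
    · ext r
      change Algebra.TensorProduct.map ψ ψ (Bialgebra.comulAlgHom (ZMod 2) _
        (baseMap PadicInt.toZMod (algebraMap _ _ r))) = Δ (φ (algebraMap _ _ r))
      rw [AlgHomClass.commutes φ, Δ.commutes]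
      have h1 := DFunLike.congr_fun (baseMap_comp_algebraMap (PadicInt.toZMod (p := 2))) r
      simp only [RingHom.comp_apply] at h1
      rw [h1, AlgHom.commutes, AlgHom.commutes]
      rfl
    · ext i k
      change Algebra.TensorProduct.map ψ ψ (Bialgebra.comulAlgHom (ZMod 2) _
        (baseMap PadicInt.toZMod (gen _ i k))) =
        Algebra.TensorProduct.lift q₁ q₂ (fun _ _ ↦ Commute.all _ _)
          (Coalgebra.comul (R := ℤ_[2]) (φ (gen _ i k)))
      have h1 : Coalgebra.comul (R := ℤ_[2]) (φ (gen _ i k)) =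
          ∑ l, φ (gen _ i l) ⊗ₜ[ℤ_[2]] φ (gen _ l k) := by
        rw [← CoalgHomClass.map_comp_comul_apply]
        have := comul_gen (R := ℤ_[2]) i k
        rw [Bialgebra.comulAlgHom_apply] at this
        rw [this, map_sum]
        rfl
      have h2 (a b : B) : Algebra.TensorProduct.lift q₁ q₂ (fun _ _ ↦ Commute.all _ _)
          (a ⊗ₜ[ℤ_[2]] b) = q a ⊗ₜ[ZMod 2] q b := by
        rw [Algebra.TensorProduct.lift_tmul]
        change q a ⊗ₜ[ZMod 2] 1 * 1 ⊗ₜ[ZMod 2] q b = _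
        rw [Algebra.TensorProduct.tmul_mul_tmul, one_mul, mul_one]
      rw [h1, baseMap_gen, comul_gen, map_sum, map_sum]
      refine Finset.sum_congr rfl fun l _ ↦ ?_
      rw [h2, Algebra.TensorProduct.map_tmul, ← hψ, ← hψ, baseMap_gen, baseMap_gen]
  refine (DFunLike.congr_fun hΔ x).trans ?_
  obtain ⟨b, hb⟩ := hq (φ x) (by rw [← hψ]; exact hf)
  change Δ (φ x) = 0
  rw [hb, map_mul, map_ofNat, two_eq_zero_of_algebra, zero_mul]

theorem gen_zero_one_notMem_ker (hB : ∀ b : B, 2 * b = 0 → b = 0)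
    (hq : ∀ b, q b = 0 ↔ (2 : B) ∣ b)
    (h : (ψ : FixedRing (ZMod 2) →+* C).comp (baseMap PadicInt.toZMod) =
      q.comp (φ : FixedRing ℤ_[2] →+* B))
    (hnil : RingHom.ker ψ ≤ nilradical _) : gen _ 0 1 ∉ RingHom.ker ψ := by
  intro hmem
  have hψ (i j : Fin 3) : ψ (gen _ i j) = q (φ (gen _ i j)) := by
    rw [← baseMap_gen PadicInt.toZMod]
    exact DFunLike.congr_fun h _
  rw [RingHom.mem_ker, hψ, hq] at hmem
  obtain ⟨b, hb⟩ := hmem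
  have h00 := congrFun₂ (mul_J_mul_transpose (det_gen ℤ_[2]) (twist_gen ℤ_[2])) 0 0
  simp [J, Matrix.mul_apply, Fin.sum_univ_three] at h00
  have h00' := congrArg φ h00
  simp only [map_add, map_neg, map_mul, map_zero, hb] at h00'
  -- The relation reads `4b² = 2 * φ (M 0 0) * φ (M 0 2)`; torsion-freeness cancels one factor `2`.
  have hdvd : φ (gen _ 0 0) * φ (gen _ 0 2) = 2 * (b * b) :=
    sub_eq_zero.mp (hB _ (by linear_combination -h00'))
  have hker : gen _ 0 0 * gen _ 0 2 ∈ RingHom.ker ψ := by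
    rw [RingHom.mem_ker, map_mul, hψ, hψ, ← map_mul, hq]
    exact ⟨_, hdvd⟩
  -- At this unipotent point both `M 0 0` and `M 0 2` equal `1`.
  have hpt := le_ker_blockHom hnil (T := ZMod 2) (p := 1) (q := 1) (r := 0) (s := 1) (by ring) hker
  rw [RingHom.mem_ker, map_mul] at hpt
  have e := map_gen_blockHom (T := ZMod 2) (p := 1) (q := 1) (r := 0) (s := 1) (by ring)
  have e00 := congrFun₂ e 0 0
  have e02 := congrFun₂ e 0 2
  simp only [Matrix.map_apply] at e00 e02
  rw [e00, e02] at hpt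
  simp [block] at hpt

theorem injective_of_ker_le_nilradical (hB : ∀ b : B, 2 * b = 0 → b = 0)
    (hq : ∀ b, q b = 0 ↔ (2 : B) ∣ b)
    (h : (ψ : FixedRing (ZMod 2) →+* C).comp (baseMap PadicInt.toZMod) =
      q.comp (φ : FixedRing ℤ_[2] →+* B))
    (hnil : RingHom.ker ψ ≤ nilradical _) : Function.Injective ψ :=
  (RingHom.injective_iff_ker_eq_bot ψ).mpr <|
    (eq_bot_or_gen_mem hnil (isMultiplicative_ker φ q ψ (fun b ↦ (hq b).mp) h)).resolve_right
      (gen_zero_one_notMem_ker φ q ψ hB hq h hnil)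

end Reduction

/-! ### From coordinate rings to schemes. -/

theorem specialFiber_comp {H H' : Grp (Over (Spec (.of ℤ_[2])))} (f : H' ⟶ H)
    (π : H ⟶ SL3Fixed ℤ_[2]) : specialFiber (f ≫ π) =
      (Over.pullback (Spec.map (CommRingCat.ofHom (PadicInt.toZMod (p := 2))))).map f.hom.hom ≫
        specialFiber π := by
  simp [specialFiber]

/-- This determines the special fibre on coordinate rings, since the universal matrix over `𝔽₂` is
the reduction of the one over `ℤ₂`. -/
theorem specialFiber_left_baseMap {H : Grp (Over (Spec (.of ℤ_[2])))}
    (π : H ⟶ SL3Fixed ℤ_[2]) :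
    (specialFiber π).left ≫ Spec.map (CommRingCat.ofHom (baseMap (PadicInt.toZMod (p := 2)))) =
      pullback.fst _ _ ≫ π.hom.hom.left := by
  have h := (SL3Fixed.isPullback (PadicInt.toZMod (p := 2))).isoPullback_inv_fst
  refine (Category.assoc _ _ _).trans ((congrArg (_ ≫ ·) h).trans ?_)
  exact pullback.lift_fst _ _ _

theorem ker_specMap_eq_bot {A C : CommRingCat} (f : A ⟶ C)
    (hf : Function.Injective f) : (Spec.map f).ker = ⊥ := by
  have e : (Spec.map f).appTop = (Scheme.ΓSpecIso A).hom ≫ f ≫ (Scheme.ΓSpecIso C).inv := by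
    rw [← Category.assoc, Iso.eq_comp_inv]
    exact Scheme.ΓSpecIso_naturality f
  have h : Function.Injective (Spec.map f).appTop := by
    rw [e]
    exact ((ConcreteCategory.bijective_of_isIso (Scheme.ΓSpecIso C).inv).1.comp hf).comp
      (ConcreteCategory.bijective_of_isIso (Scheme.ΓSpecIso A).hom).1
  refine Scheme.IdealSheafData.ext_of_isAffine ?_
  rw [(Spec.map f).ker_apply ⟨⊤, isAffineOpen_top _⟩]
  exact (RingHom.injective_iff_ker_eq_bot _).mp h

theorem ker_le_nilradical_of_surjective {A C : CommRingCat} (f : A ⟶ C)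
    (hf : Surjective (Spec.map f)) : RingHom.ker f.hom ≤ nilradical A := by
  rw [← PrimeSpectrum.denseRange_comap_iff_ker_le_nilRadical]
  exact hf.surj.denseRange

/-- The residue field of `ℤ₂` as an algebra. -/
abbrev residueAlgebra : Algebra ℤ_[2] (ZMod 2) := (PadicInt.toZMod (p := 2)).toAlgebra

attribute [local instance] residueAlgebra Algebra.TensorProduct.rightAlgebra

theorem tmul_one_eq_zero_iff {B : Type*} [CommRing B] [Algebra ℤ_[2] B] (b : B) :
    b ⊗ₜ[ℤ_[2]] (1 : ZMod 2) = 0 ↔ (2 : B) ∣ b := by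
  constructor
  · intro h
    have hk := Algebra.TensorProduct.lTensor_ker (A := B) (Algebra.ofId ℤ_[2] (ZMod 2))
      toZMod_surjective
    have hb : b ⊗ₜ[ℤ_[2]] (1 : ℤ_[2]) ∈ RingHom.ker
        (Algebra.TensorProduct.map (AlgHom.id ℤ_[2] B) (Algebra.ofId ℤ_[2] (ZMod 2))) := by
      rw [RingHom.mem_ker, Algebra.TensorProduct.map_tmul, map_one]
      exact h
    have hker : RingHom.ker (Algebra.ofId ℤ_[2] (ZMod 2)) = Ideal.span {2} :=
      PadicInt.ker_toZMod.trans PadicInt.maximalIdeal_eq_span_p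
    rw [hk, hker, Ideal.map_span, Set.image_singleton, Ideal.mem_span_singleton] at hb
    have := map_dvd (Algebra.TensorProduct.rid ℤ_[2] ℤ_[2] B) hb
    rw [Algebra.TensorProduct.includeRight_apply, Algebra.TensorProduct.rid_tmul,
      Algebra.TensorProduct.rid_tmul, one_smul, Algebra.smul_def, map_ofNat, mul_one] at this
    exact this
  · rintro ⟨c, rfl⟩
    have h : (2 * c) ⊗ₜ[ℤ_[2]] (1 : ZMod 2) = 2 * c ⊗ₜ[ℤ_[2]] (1 : ZMod 2) := by
      rw [two_mul, two_mul, add_tmul]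
    rw [h, two_eq_zero_of_algebra, zero_mul]

theorem eq_zero_of_two_mul_eq_zero {B : Type*} [CommRing B] [Algebra ℤ_[2] B]
    [Module.Flat ℤ_[2] B] (b : B) (h : 2 * b = 0) : b = 0 := by
  have h2 : IsSMulRegular ℤ_[2] (2 : ℤ_[2]) :=
    (IsLeftRegular.isSMulRegular (IsRegular.of_ne_zero two_ne_zero).left)
  have := h2.of_flat (S := B)
  rw [map_ofNat] at this
  exact this (by simpa using h)

theorem ker_specialFiber_hopfSpec {B : Type} [CommRing B] [HopfAlgebra ℤ_[2] B]
    [Module.Flat ℤ_[2] B] (φ : FixedRing ℤ_[2] →ₐc[ℤ_[2]] B)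
    (h : Surjective (specialFiber
      ((hopfSpec (.of ℤ_[2])).map (CommHopfAlgCat.ofHom φ).op)).left) :
    (specialFiber ((hopfSpec (.of ℤ_[2])).map (CommHopfAlgCat.ofHom φ).op)).left.ker = ⊥ := by
  let π : (hopfSpec (.of ℤ_[2])).obj (.op (.of ℤ_[2] B)) ⟶ SL3Fixed ℤ_[2] :=
    (hopfSpec (.of ℤ_[2])).map (CommHopfAlgCat.ofHom φ).op
  let g : pullback (Spec.map (CommRingCat.ofHom (algebraMap ℤ_[2] B)))
      (Spec.map (CommRingCat.ofHom (algebraMap ℤ_[2] (ZMod 2)))) ⟶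
      Spec (.of (FixedRing (ZMod 2))) := (specialFiber π).left
  have hg : Surjective g := h
  have hgb : g ≫ Spec.map (CommRingCat.ofHom (baseMap (PadicInt.toZMod (p := 2)))) =
      pullback.fst _ _ ≫ Spec.map (CommRingCat.ofHom (φ : FixedRing ℤ_[2] →+* B)) :=
    specialFiber_left_baseMap π
  obtain ⟨ψ, hψ⟩ := Spec.map_surjective ((pullbackSpecIso ℤ_[2] B (ZMod 2)).inv ≫ g)
  have hbase : CommRingCat.ofHom (baseMap (PadicInt.toZMod (p := 2))) ≫ ψ =
      CommRingCat.ofHom (φ : FixedRing ℤ_[2] →+* B) ≫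
        CommRingCat.ofHom Algebra.TensorProduct.includeLeftRingHom := by
    apply Spec.map_injective
    rw [Spec.map_comp, Spec.map_comp, hψ, ← pullbackSpecIso_inv_fst ℤ_[2] B (ZMod 2),
      Category.assoc, Category.assoc, hgb]
  -- Linearity over `𝔽₂` is automatic, as ring maps out of `ZMod 2` are unique.
  let ψ' : FixedRing (ZMod 2) →ₐ[ZMod 2] B ⊗[ℤ_[2]] ZMod 2 :=
    { ψ.hom with commutes' := fun r ↦ DFunLike.congr_fun (RingHom.ext_zmod
        (ψ.hom.comp (algebraMap (ZMod 2) (FixedRing (ZMod 2)))) (algebraMap _ _)) r }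
  have hf : Surjective (Spec.map ψ) := by
    rw [hψ]
    infer_instance
  have hinj : Function.Injective ψ' := injective_of_ker_le_nilradical φ
    (Algebra.TensorProduct.includeLeftRingHom : B →+* B ⊗[ℤ_[2]] ZMod 2) ψ'
    eq_zero_of_two_mul_eq_zero tmul_one_eq_zero_iff
    (congrArg CommRingCat.Hom.hom hbase) (ker_le_nilradical_of_surjective ψ hf)
  have hker := ker_specMap_eq_bot ψ hinj
  rwa [hψ, Scheme.Hom.ker_comp_of_isIso] at hker

end SLFix

theorem mainTheorem10 (H : Grp (Over (Spec (.of ℤ_[2]))))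
    (hflat : Flat H.X.hom) (haff : IsAffine H.X.left)
    (π : H ⟶ SLFix.SL3Fixed ℤ_[2])
    (hπ : Surjective (SLFix.specialFiber π).left) :
    IsIso (Scheme.Hom.imageι (SLFix.specialFiber π).left) := by
  -- An affine group scheme is the spectrum of a Hopf algebra, and full faithfulness turns `π` into
  -- a bialgebra map.
  obtain ⟨B, ⟨e⟩⟩ := (essImage_hopfSpec (R := .of ℤ_[2])).mpr haff
  let φ : SLFix.FixedRing ℤ_[2] →ₐc[ℤ_[2]] B.unop :=
    (hopfSpec.fullyFaithful.preimage (e.hom ≫ π)).unop.hom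
  have hφ : (hopfSpec (.of ℤ_[2])).map (CommHopfAlgCat.ofHom φ).op = e.hom ≫ π :=
    hopfSpec.fullyFaithful.map_preimage (e.hom ≫ π)
  let e' := (Grp.forget _).mapIso e
  have hflat' : Module.Flat ℤ_[2] B.unop := by
    have he : IsIso e.hom.hom.hom.left := ((Over.forget _).mapIso e').isIso_hom
    have h : Flat (e.hom.hom.hom.left ≫ H.X.hom) := inferInstance
    rw [Over.w] at h
    exact (RingHom.flat_algebraMap_iff).mp (Flat.SpecMap_iff.mp h)
  have he : IsIso ((Over.pullback (Spec.map (CommRingCat.ofHom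
      (PadicInt.toZMod (p := 2))))).map e.hom.hom.hom).left :=
    ((Over.pullback _ ⋙ Over.forget _).mapIso e').isIso_hom
  have hcomp := SLFix.specialFiber_comp e.hom π
  have hker := SLFix.ker_specialFiber_hopfSpec φ (by
    rw [hφ, hcomp, Over.comp_left]; infer_instance)
  rw [hφ, hcomp, Over.comp_left, Scheme.Hom.ker_comp_of_isIso] at hker
  -- The schematic image is the closed subscheme cut out by the kernel.
  exact (Scheme.isIso_subschemeι_iff_eq_bot _).mpr hker

end
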